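/- For a positive integer $n$ and $k\ge 1$ let $\sigma_k(n)=\sum_{d\mid n}d^k$, $\sigma=\sigma_1$, and let $\tau(n)$ be Ramanujan's tau function, defined by $q\prod_{k\ge1}(1-q^k)^{24}=\sum_{n\ge1}\tau(n)q^n$, where $q=e^{2\pi i z}$, $\operatorname{Im} z>0$. Then for every integer $n\ge 1$: (i) $\tau(n)=\frac{5\cdot 691}{9504}\sigma(n)-\frac{(6n-5)\cdot 691}{864}\sigma_9(n)+\frac{2275}{1584}\sigma_{11}(n)-\frac{5\cdot 691}{36}\sum_{m=1}^{n-1}\sigma(m)\sigma_9(n-m)$; (ii) $\tau(n)=\frac{15}{32}n\sigma(n)-\frac{33}{32}n\sigma_9(n)+\frac{50}{32}n^2\sigma_7(n)+225\sum_{m=1}^{n-1}m\,\sigma(m)\sigma_7(n-m)$; (iii) $\tau(n)=\frac{6}{7}n^2\sigma(n)-\frac{9}{7}n^3\sigma_5(n)+\frac{10}{7}n^2\sigma_7(n)-24\cdot 18\sum_{m=1}^{n-1}m^2\sigma(m)\sigma_5(n-m)$; (iv) $\tau(n)=\frac{14}{5}n^3\sigma(n)+\frac{12}{5}n^4\sigma_3(n)-\frac{21}{5}n^3\sigma_5(n)+24\cdot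 28\sum_{m=1}^{n-1}m^3\sigma(m)\sigma_3(n-m)$; (v) $\tau(n)=\frac{5}{12}n\sigma(n)+\frac{25}{24}n\sigma_7(n)-\frac{11}{24}n\sigma_9(n)+25\sum_{m=1}^{n-1}(9m-n)\sigma(m)\sigma_7(n-m)$; (vi) $\tau(n)=\frac{9}{14}n^2\sigma(n)+\frac{5}{14}n^2\sigma_7(n)-108\sum_{m=1}^{n-1}(4m^2-mn)\sigma(m)\sigma_5(n-m)$; (vii) $\tau(n)=\frac{8}{5}n^3\sigma(n)-\frac{3}{5}n^3\sigma_5(n)+96\sum_{m=1}^{n-1}(7m^3-3m^2n)\sigma(m)\sigma_3(n-m)$; (viii) $\tau(n)=\frac{1}{2}n^2\sigma(n)+\frac{1}{2}n^2\sigma_5(n)-12\sum_{m=1}^{n-1}(36m^2-16mn+n^2)\sigma(m)\sigma_5(n-m)$; (ix) $\tau(n)=n^3\sigma(n)-24\sum_{m=1}^{n-1}(21m^2n-28m^3-3mn^2)\sigma(m)\sigma_3(n-m)$. -/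

import Mathlib

open scoped ArithmeticFunction.sigma

/-- The Ramanujan tau function: `ramanujanTau n` is the `n`-th coefficient of the `q`-expansion of
the modular discriminant `Δ(z) = η(z) ^ 24 = q ∏_{k ≥ 1} (1 - q ^ k) ^ 24`, `q = exp (2πiz)`. -/
noncomputable def ramanujanTau (n : ℕ) : ℂ :=
  (UpperHalfPlane.qExpansion 1 ModularForm.discriminant).coeff n

/-- The defining expansion `q ∏_{k ≥ 1} (1 - q ^ k) ^ 24 = ∑_n τ(n) q ^ n` on the upper half
plane. -/
theorem hasSum_ramanujanTau (z : UpperHalfPlane) :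
    HasSum (fun n : ℕ => ramanujanTau n * Complex.exp (2 * Real.pi * Complex.I * z) ^ n)
      (Complex.exp (2 * Real.pi * Complex.I * z) *
        ∏' k : ℕ, (1 - Complex.exp (2 * Real.pi * Complex.I * z) ^ (k + 1)) ^ 24) := by
  have h := ModularForm.hasSum_qExpansion CuspForm.discriminant (h := 1) one_pos (by simp) z
  rw [CuspForm.coe_discriminant, ModularForm.discriminant_eq_q_prod] at h
  simpa [ramanujanTau, ModularForm.eta_q, Function.Periodic.qParam] using h

/-! Each identity is a polynomial identity in the Eisenstein series P = E₂, Q = E₄, R = E₆.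
Multiplying the `n`-th coefficient by `n` is the Euler operator D = q d/dq, and a convolution sum is
a coefficient of a product of series. Ramanujan's equations DP = (P² - Q)/12, DQ = (PQ - R)/3, DR =
(PR - Q²)/2 make ℂ[P, Q, R] stable under D. It contains the generating series of σ₁, σ₃, σ₅ by
definition, those of σ₇, σ₉, σ₁₁ because E₈, E₁₀, E₁₂ are polynomials in E₄ and E₆, and that of τ
because Δ = (Q³ - R²)/1728. The modular input is a Sturm bound: level one forms of equal weight
below 24 that share their first two coefficients coincide. For Ramanujan's equations it is applied
to the Serre derivatives of E₄ and E₆ and to the analogue DE₂ - E₂²/12. -/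

section

open UpperHalfPlane hiding I
open Complex ModularForm EisensteinSeries Derivative
open scoped Manifold MatrixGroups PowerSeries

/-! ### Euler operator and q-expansions -/

/-- The Euler operator `q d/dq` on formal power series. -/
noncomputable def eulerDerivation : Derivation ℂ ℂ⟦X⟧ ℂ⟦X⟧ :=
  (PowerSeries.X : ℂ⟦X⟧) • PowerSeries.derivative ℂ

lemma coeff_eulerDerivation (A : ℂ⟦X⟧) (n : ℕ) :
    (eulerDerivation A).coeff n = n * A.coeff n := by
  rcases n with _ | n
  · simp [eulerDerivation]
  · simp [eulerDerivation, PowerSeries.coeff_succ_X_mul, PowerSeries.coeff_derivative, mul_comm]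

@[simp]
lemma constantCoeff_eulerDerivation (A : ℂ⟦X⟧) :
    PowerSeries.constantCoeff (eulerDerivation A) = 0 := by
  simp [eulerDerivation]

/-- A holomorphic function on the upper half plane given by the `q`-expansion `A`. -/
structure HasQExpansion (f : ℍ → ℂ) (A : ℂ⟦X⟧) : Prop where
  mdifferentiable : MDiff f
  hasSum : ∀ τ : ℍ, HasSum (fun m ↦ A.coeff m • Function.Periodic.qParam 1 τ ^ m) (f τ)

namespace HasQExpansion

variable {f g : ℍ → ℂ} {A B : ℂ⟦X⟧}

lemma add (hf : HasQExpansion f A) (hg : HasQExpansion g B) : HasQExpansion (f + g) (A + B) where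
  mdifferentiable := hf.mdifferentiable.add hg.mdifferentiable
  hasSum τ := by simpa [add_mul] using (hf.hasSum τ).add (hg.hasSum τ)

lemma smul (c : ℂ) (hf : HasQExpansion f A) : HasQExpansion (c • f) (c • A) where
  mdifferentiable := hf.mdifferentiable.const_smul c
  hasSum τ := by simpa [mul_assoc] using (hf.hasSum τ).mul_left c

lemma mul (hf : HasQExpansion f A) (hg : HasQExpansion g B) : HasQExpansion (f * g) (A * B) where
  mdifferentiable := hf.mdifferentiable.mul hg.mdifferentiable
  hasSum τ := by
    have h1 := (hf.hasSum τ).summable.norm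
    have h2 := (hg.hasSum τ).summable.norm
    have h3 := (summable_norm_sum_mul_antidiagonal_of_summable_norm h1 h2).of_norm.hasSum
    rw [← tsum_mul_tsum_eq_tsum_sum_antidiagonal_of_summable_norm h1 h2,
      (hf.hasSum τ).tsum_eq, (hg.hasSum τ).tsum_eq] at h3
    refine h3.congr_fun fun m ↦ ?_
    rw [PowerSeries.coeff_mul, Finset.sum_smul]
    refine Finset.sum_congr rfl fun p hp ↦ ?_
    rw [← Finset.HasAntidiagonal.mem_antidiagonal.mp hp, pow_add]
    simp only [smul_eq_mul]
    ring

lemma isBoundedAtImInfty (hf : HasQExpansion f A) : IsBoundedAtImInfty f :=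
  isBoundedAtImInfty_of_hasSum_qExpansion one_pos hf.hasSum

lemma periodic (hf : HasQExpansion f A) : Function.Periodic (f ∘ ofComplex) (1 : ℝ) := by
  intro w
  by_cases hw : 0 < w.im
  · have hw' : 0 < (w + (1 : ℝ)).im := by simpa using hw
    simp only [Function.comp_apply, ofComplex_apply_of_im_pos hw, ofComplex_apply_of_im_pos hw']
    refine (hf.hasSum _).unique ?_
    convert! hf.hasSum ⟨w, hw⟩ using 4
    simp [Function.Periodic.qParam, mul_add, exp_add]
  -- Off the upper half plane `ofComplex` takes a constant default value, so periodicity is trivial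
  -- there.
  · have hw' : ¬ 0 < (w + (1 : ℝ)).im := by simpa using hw
    simp only [not_lt] at hw hw'
    simp only [Function.comp_apply, ofComplex_apply_of_im_nonpos hw,
      ofComplex_apply_of_im_nonpos hw']

/-- Both sides are Taylor coefficients at 0 of the same analytic function, the cusp function of `f`.
-/
lemma coeff_eq (hf : HasQExpansion f A) (m : ℕ) : A.coeff m = (qExpansion 1 f).coeff m := by
  have han := analyticAt_cuspFunction_zero one_pos hf.periodic hf.mdifferentiable
    hf.isBoundedAtImInfty
  have h := (hasFPowerSeriesOnBall_cuspFunction one_pos han hf.hasSum).hasFPowerSeriesAt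
    |>.eq_formalMultilinearSeries han.hasFPowerSeriesAt
  simpa [qExpansion_coeff, div_eq_mul_inv, mul_comm, FormalMultilinearSeries.coeff_ofScalars]
    using congr_arg (FormalMultilinearSeries.coeff · m) h

lemma eq_qExpansion (hf : HasQExpansion f A) : A = qExpansion 1 f :=
  PowerSeries.ext hf.coeff_eq

/-- With `f = F(q)` and dq/dz = 2πi q, the chain rule gives (2πi)⁻¹ df/dz = q F'(q). The Taylor
series of F' on the unit disc, multiplied by q, is the claimed expansion. -/
lemma normalizedDerivOfComplex (hf : HasQExpansion f A) :
    HasQExpansion (normalizedDerivOfComplex f) (eulerDerivation A) where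
  mdifferentiable := normalizedDerivOfComplex_mdifferentiable hf.mdifferentiable
  hasSum τ := by
    set q := Function.Periodic.qParam 1 τ with hq
    have hq1 : ‖q‖ < 1 := Function.Periodic.norm_qParam_lt_one one_pos τ.im_pos
    have hdiff := differentiableOn_cuspFunction_ball one_pos hf.periodic hf.mdifferentiable
      hf.isBoundedAtImInfty
    have hsum := (hasSum_taylorSeries_on_ball (hdiff.deriv Metric.isOpen_ball)
      (z := q) (by simpa using hq1)).mul_left q
    have hval : Derivative.normalizedDerivOfComplex f τ = q * deriv (cuspFunction 1 f) q := by
      have h1 : f ∘ ofComplex =ᶠ[nhds ↑τ] cuspFunction 1 f ∘ Function.Periodic.qParam 1 := by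
        filter_upwards [isOpen_upperHalfPlaneSet.mem_nhds τ.im_pos] with w hw
        exact (Function.Periodic.eq_cuspFunction one_ne_zero hf.periodic w).symm
      have h2 : HasDerivAt (Function.Periodic.qParam 1) (q * (2 * Real.pi * I)) (τ : ℂ) := by
        have h := (((hasDerivAt_id (τ : ℂ)).const_mul (2 * Real.pi * I)).div_const
          ((1 : ℝ) : ℂ)).cexp
        have he : Function.Periodic.qParam 1 = fun z ↦ cexp (2 * Real.pi * I * z / (1 : ℝ)) := rfl
        simpa [he, hq] using h
      have h3 : HasDerivAt (cuspFunction 1 f) (deriv (cuspFunction 1 f) q) q :=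
        (hdiff.differentiableAt (Metric.isOpen_ball.mem_nhds (by simpa using hq1))).hasDerivAt
      rw [Derivative.normalizedDerivOfComplex, h1.deriv_eq, (h3.comp (τ : ℂ) h2).deriv]
      field [two_pi_I_ne_zero]
    -- The constant term is zero, and the factor q shifts the series of F' by one.
    rw [hval, ← hasSum_nat_add_iff' 1]
    convert! hsum using 1
    · ext m
      rw [coeff_eulerDerivation, hf.coeff_eq, qExpansion_coeff, ← iteratedDeriv_succ',
        Nat.factorial_succ]
      have : (m.factorial : ℂ) ≠ 0 := by exact_mod_cast m.factorial_ne_zero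
      have : (m + 1 : ℂ) ≠ 0 := by exact_mod_cast m.succ_ne_zero
      push_cast
      simp only [smul_eq_mul, sub_zero]
      field_simp
      ring
    · simp [coeff_eulerDerivation]

end HasQExpansion

/-! ### Level one forms and the Sturm bound -/

/-- A holomorphic function, invariant under the weight `k` action of `SL(2, ℤ)`, given by the
`q`-expansion `A`. -/
structure IsLevelOneForm (k : ℤ) (f : ℍ → ℂ) (A : ℂ⟦X⟧) : Prop extends HasQExpansion f A where
  slash_eq : ∀ γ : SL(2, ℤ), f ∣[k] γ = f

namespace IsLevelOneForm

variable {k l : ℤ} {f g : ℍ → ℂ} {A B : ℂ⟦X⟧}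

lemma of_modularForm (f : ModularForm 𝒮ℒ k) : IsLevelOneForm k f (qExpansion 1 f) where
  mdifferentiable := f.holo'
  hasSum := ModularForm.hasSum_qExpansion f one_pos one_mem_strictPeriods_SL
  slash_eq γ := by
    simpa [ModularForm.SL_slash] using! f.slash_action_eq' (γ : GL (Fin 2) ℝ) ⟨γ, rfl⟩

lemma add (hf : IsLevelOneForm k f A) (hg : IsLevelOneForm k g B) :
    IsLevelOneForm k (f + g) (A + B) where
  toHasQExpansion := hf.toHasQExpansion.add hg.toHasQExpansion
  slash_eq γ := by rw [SlashAction.add_slash, hf.slash_eq, hg.slash_eq]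

lemma smul (c : ℂ) (hf : IsLevelOneForm k f A) : IsLevelOneForm k (c • f) (c • A) where
  toHasQExpansion := hf.toHasQExpansion.smul c
  slash_eq γ := by rw [ModularForm.SL_smul_slash, hf.slash_eq]

lemma mul (hf : IsLevelOneForm k f A) (hg : IsLevelOneForm l g B) :
    IsLevelOneForm (k + l) (f * g) (A * B) where
  toHasQExpansion := hf.toHasQExpansion.mul hg.toHasQExpansion
  slash_eq γ := by rw [ModularForm.mul_slash_SL2, hf.slash_eq, hg.slash_eq]

/-- A level one form of weight less than `24` is determined by its first two coefficients. -/
lemma eq_zero (hf : IsLevelOneForm k f A) (hk : k < 24) (h0 : A.coeff 0 = 0)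
    (h1 : A.coeff 1 = 0) : A = 0 := by
  let F : ModularForm 𝒮ℒ k :=
    { toFun := f
      slash_action_eq' := by
        rintro _ ⟨γ, rfl⟩
        exact hf.slash_eq γ
      holo' := hf.mdifferentiable
      bdd_at_cusps' := fun hc ↦ by
        rw [OnePoint.isBoundedAt_iff_forall_SL2Z hc]
        intro γ _
        rw [hf.slash_eq]
        exact hf.isBoundedAtImInfty }
  have hA : A = qExpansion 1 F := hf.eq_qExpansion
  have hF : F = 0 := by
    apply sturm_bound_levelOne
    rw [← hA]
    -- The order at the cusp is at least 2, which exceeds k/12.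
    refine lt_of_lt_of_le (b := ((2 : ℕ) : ℕ∞)) (by norm_cast; omega) ?_
    refine PowerSeries.nat_le_order _ _ fun i hi ↦ ?_
    interval_cases i <;> assumption
  rw [hA, hF]
  simp [qExpansion_zero]

lemma eq_of_coeff (hf : IsLevelOneForm k f A) (hg : IsLevelOneForm k g B) (hk : k < 24)
    (h0 : A.coeff 0 = B.coeff 0) (h1 : A.coeff 1 = B.coeff 1) : A = B := by
  have := (hf.add (hg.smul (-1))).eq_zero hk
    (by simp only [map_add, PowerSeries.coeff_smul, h0]; simp)
    (by simp only [map_add, PowerSeries.coeff_smul, h1]; simp)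
  rwa [neg_one_smul, ← sub_eq_add_neg, sub_eq_zero] at this

end IsLevelOneForm

/-! ### Eisenstein series -/

/-- The generating series of `σ k`. -/
noncomputable def sigmaSeries (k : ℕ) : ℂ⟦X⟧ := PowerSeries.mk fun n ↦ (σ k n : ℂ)

lemma coeff_sigmaSeries (k n : ℕ) : (sigmaSeries k).coeff n = σ k n := by
  simp [sigmaSeries]

/-- The `q`-expansion of `E₂`. -/
noncomputable def ramanujanP : ℂ⟦X⟧ := 1 - (24 : ℂ) • sigmaSeries 1

/-- The `q`-expansion of `E₄`. -/
noncomputable def ramanujanQ : ℂ⟦X⟧ := 1 + (240 : ℂ) • sigmaSeries 3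

/-- The `q`-expansion of `E₆`. -/
noncomputable def ramanujanR : ℂ⟦X⟧ := 1 - (504 : ℂ) • sigmaSeries 5

lemma hasQExpansion_E2 : HasQExpansion E2 ramanujanP where
  mdifferentiable := E2_mdifferentiable
  hasSum τ := by
    convert! hasSum_qExpansion_E2 (z := τ) using 2 with m
    rcases eq_or_ne m 0 with rfl | hm
    · simp [ramanujanP, sigmaSeries]
    · simp [ramanujanP, coeff_sigmaSeries, PowerSeries.coeff_one, hm,
        Function.Periodic.qParam]

lemma isLevelOneForm_E {k : ℕ} (hk : 3 ≤ k) (hk2 : Even k) {b : ℂ}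
    (hb : -(2 * k / bernoulli k : ℂ) = b) :
    IsLevelOneForm k (E hk) (1 + b • sigmaSeries (k - 1)) := by
  convert! IsLevelOneForm.of_modularForm (E hk) using 1
  ext m
  rw [E_qExpansion_coeff hk hk2, hb]
  rcases eq_or_ne m 0 with rfl | hm
  · simp [sigmaSeries]
  · simp [coeff_sigmaSeries, PowerSeries.coeff_one, hm]

lemma isLevelOneForm_E_four : IsLevelOneForm 4 E₄ ramanujanQ :=
  isLevelOneForm_E _ ⟨2, rfl⟩ (by norm_num [show bernoulli 4 = -1 / 30 by decide +kernel])

lemma isLevelOneForm_E_six : IsLevelOneForm 6 E₆ ramanujanR := by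
  rw [ramanujanR, sub_eq_add_neg, ← neg_smul (504 : ℂ)]
  exact isLevelOneForm_E _ ⟨3, rfl⟩ (by norm_num [show bernoulli 6 = 1 / 42 by decide +kernel])

lemma isLevelOneForm_E_eight :
    IsLevelOneForm 8 (E (by norm_num : 3 ≤ 8)) (1 + (480 : ℂ) • sigmaSeries 7) :=
  isLevelOneForm_E _ ⟨4, rfl⟩ (by norm_num [show bernoulli 8 = -1 / 30 by decide +kernel])

lemma isLevelOneForm_E_ten :
    IsLevelOneForm 10 (E (by norm_num : 3 ≤ 10)) (1 + (-264 : ℂ) • sigmaSeries 9) :=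
  isLevelOneForm_E _ ⟨5, rfl⟩ (by norm_num [show bernoulli 10 = 5 / 66 by decide +kernel])

lemma isLevelOneForm_E_twelve :
    IsLevelOneForm 12 (E (by norm_num : 3 ≤ 12)) (1 + (65520 / 691 : ℂ) • sigmaSeries 11) :=
  isLevelOneForm_E _ ⟨6, rfl⟩ (by norm_num [show bernoulli 12 = -691 / 2730 by decide +kernel])

/-! ### Serre derivatives and Ramanujan's differential equations -/

lemma IsLevelOneForm.serreDerivative {k : ℤ} {f : ℍ → ℂ} {A : ℂ⟦X⟧} (hf : IsLevelOneForm k f A) :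
    IsLevelOneForm (k + 2) (serreDerivative k f)
      (eulerDerivation A + (-(k / 12) : ℂ) • (ramanujanP * A)) where
  toHasQExpansion := by
    convert! hf.normalizedDerivOfComplex.add
      ((hasQExpansion_E2.mul hf.toHasQExpansion).smul (-(k / 12) : ℂ)) using 1
    ext z
    simp [Derivative.serreDerivative]
    ring
  slash_eq γ := serreDerivative_slash_invariant hf.mdifferentiable (hf.slash_eq γ)

lemma normalizedDerivOfComplex_D2 (γ : SL(2, ℤ)) (z : ℍ) :
    normalizedDerivOfComplex (D2 γ) z = -(γ 1 0 / denom γ z) ^ 2 := by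
  have hz := denom_ne_zero γ z
  have h : HasDerivAt (fun w : ℂ ↦ (2 * Real.pi * I * γ 1 0) * (denom γ w) ^ (-1 : ℤ))
      ((2 * Real.pi * I * γ 1 0) * (-(γ 1 0 : ℂ) * (denom γ z) ^ (-2 : ℤ))) (z : ℂ) := by
    simpa using (hasDerivAt_denom_zpow (γ : GL (Fin 2) ℝ) (-1) z).const_mul
      (2 * Real.pi * I * γ 1 0 : ℂ)
  have he : D2 γ ∘ ofComplex =ᶠ[nhds ↑z]
      fun w : ℂ ↦ (2 * Real.pi * I * γ 1 0) * (denom γ w) ^ (-1 : ℤ) := by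
    filter_upwards [isOpen_upperHalfPlaneSet.mem_nhds z.im_pos] with w hw
    simp [D2, ofComplex_apply_of_im_pos hw, div_eq_mul_inv]
  rw [normalizedDerivOfComplex, he.deriv_eq, h.deriv]
  have : (2 * Real.pi * I : ℂ) ≠ 0 := two_pi_I_ne_zero
  rw [show (-2 : ℤ) = -(2 : ℕ) by rfl, zpow_neg, zpow_natCast]
  field_simp

lemma mdifferentiable_D2 (γ : SL(2, ℤ)) : MDiff (D2 γ) := by
  -- Holomorphy is read off from the transformation law of E₂.
  have h : D2 γ = (2 * riemannZeta 2) • (E2 - E2 ∣[(2 : ℤ)] γ) := by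
    have : (2 * riemannZeta 2 : ℂ) ≠ 0 := by
      simp [riemannZeta_two, Real.pi_ne_zero]
    rw [E2_slash_action, sub_sub_cancel, smul_smul, mul_one_div_cancel this, one_smul]
  rw [h]
  exact (E2_mdifferentiable.sub (E2_mdifferentiable.slash _ _)).const_smul _

/-- E₂ is only quasimodular: slashing subtracts a multiple of X = c/(cz + d). With the factor 1/12,
rather than the 2/12 of a weight 2 form, the terms in X·E₂ and X² coming from DE₂ and from E₂²
cancel. -/
lemma isLevelOneForm_serreDerivative_E2 :
    IsLevelOneForm 4 (normalizedDerivOfComplex E2 + (-(1 / 12) : ℂ) • (E2 * E2))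
      (eulerDerivation ramanujanP + (-(1 / 12) : ℂ) • (ramanujanP * ramanujanP)) where
  toHasQExpansion := hasQExpansion_E2.normalizedDerivOfComplex.add
    ((hasQExpansion_E2.mul hasQExpansion_E2).smul _)
  slash_eq γ := by
    have hD := normalizedDerivOfComplex_SL_slash (k := 2) E2_mdifferentiable (γ := γ)
    have hE := E2_slash_action γ
    have hM := ModularForm.mul_slash_SL2 2 2 γ E2 E2
    rw [hE, normalizedDerivOfComplex_sub _ _ E2_mdifferentiable
      ((mdifferentiable_D2 γ).const_smul _),
      normalizedDerivOfComplex_smul _ _ (mdifferentiable_D2 γ)] at hD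
    rw [hE] at hM
    rw [SlashAction.add_slash, ModularForm.SL_smul_slash]
    ext z
    have hDz := congrFun hD z
    have hMz := congrFun hM z
    simp only [Pi.sub_apply, Pi.smul_apply, smul_eq_mul, normalizedDerivOfComplex_D2, D2,
      riemannZeta_two, Pi.mul_apply, Int.cast_ofNat] at hDz hMz
    norm_num at hDz hMz
    simp only [Pi.add_apply, Pi.smul_apply, smul_eq_mul, Pi.mul_apply]
    rw [hMz]
    have hX : (6 / Real.pi ^ 2 * (1 / 2) * (2 * Real.pi * I * γ 1 0 / denom γ z) : ℂ) =
        6 * I * (Real.pi : ℂ)⁻¹ * (γ 1 0 / denom γ z) := by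
      have : (Real.pi : ℂ) ≠ 0 := by exact_mod_cast Real.pi_ne_zero
      field
    rw [hX] at hDz ⊢
    linear_combination -hDz + 3 * (Real.pi : ℂ)⁻¹ ^ 2 * (γ 1 0 / denom γ z) ^ 2 * I_sq

lemma eulerDerivation_ramanujanP :
    eulerDerivation ramanujanP = (1 / 12 : ℂ) • (ramanujanP ^ 2 - ramanujanQ) := by
  have h := isLevelOneForm_serreDerivative_E2.eq_of_coeff
    (isLevelOneForm_E_four.smul (-(1 / 12))) (by norm_num)
    (by simp [ramanujanP, ramanujanQ, sigmaSeries])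
    (by simp [coeff_eulerDerivation, ramanujanP, ramanujanQ, sigmaSeries, PowerSeries.coeff_mul,
          Finset.Nat.antidiagonal_succ, PowerSeries.coeff_one]; norm_num)
  linear_combination (norm := algebra) h

lemma eulerDerivation_ramanujanQ :
    eulerDerivation ramanujanQ = (1 / 3 : ℂ) • (ramanujanP * ramanujanQ - ramanujanR) := by
  have h := isLevelOneForm_E_four.serreDerivative.eq_of_coeff
    (isLevelOneForm_E_six.smul (-(1 / 3))) (by norm_num)
    (by simp [ramanujanP, ramanujanQ, ramanujanR, sigmaSeries]; norm_num)
    (by simp [coeff_eulerDerivation, ramanujanP, ramanujanQ, ramanujanR, sigmaSeries,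
          PowerSeries.coeff_mul, Finset.Nat.antidiagonal_succ, PowerSeries.coeff_one]; norm_num)
  norm_num at h
  linear_combination (norm := algebra) h

lemma eulerDerivation_ramanujanR :
    eulerDerivation ramanujanR = (1 / 2 : ℂ) • (ramanujanP * ramanujanR - ramanujanQ ^ 2) := by
  have h := isLevelOneForm_E_six.serreDerivative.eq_of_coeff
    ((isLevelOneForm_E_four.mul isLevelOneForm_E_four).smul (-(1 / 2))) (by norm_num)
    (by simp [ramanujanP, ramanujanQ, ramanujanR, sigmaSeries]; norm_num)
    (by simp [coeff_eulerDerivation, ramanujanP, ramanujanQ, ramanujanR, sigmaSeries,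
          PowerSeries.coeff_mul, Finset.Nat.antidiagonal_succ, PowerSeries.coeff_one]; norm_num)
  norm_num at h
  linear_combination (norm := algebra) h

/-! ### The series of σ₇, σ₉, σ₁₁ and τ in terms of Q and R -/

lemma sigmaSeries_seven : sigmaSeries 7 = (1 / 480 : ℂ) • (ramanujanQ ^ 2 - 1) := by
  have h := isLevelOneForm_E_eight.eq_of_coeff
    (isLevelOneForm_E_four.mul isLevelOneForm_E_four) (by norm_num)
    (by simp [ramanujanQ, sigmaSeries])
    (by simp [ramanujanQ, sigmaSeries, PowerSeries.coeff_mul, Finset.Nat.antidiagonal_succ,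
          PowerSeries.coeff_one]; norm_num)
  linear_combination (norm := algebra) (1 / 480 : ℂ) • h

lemma sigmaSeries_nine : sigmaSeries 9 = (1 / 264 : ℂ) • (1 - ramanujanQ * ramanujanR) := by
  have h := isLevelOneForm_E_ten.eq_of_coeff
    (isLevelOneForm_E_four.mul isLevelOneForm_E_six) (by norm_num)
    (by simp [ramanujanQ, ramanujanR, sigmaSeries])
    (by simp [ramanujanQ, ramanujanR, sigmaSeries, PowerSeries.coeff_mul,
          Finset.Nat.antidiagonal_succ, PowerSeries.coeff_one]; norm_num)
  linear_combination (norm := algebra) (-1 / 264 : ℂ) • h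

lemma sigmaSeries_eleven : sigmaSeries 11 =
    (1 / 65520 : ℂ) • (441 * ramanujanQ ^ 3 + 250 * ramanujanR ^ 2 - 691) := by
  have h := isLevelOneForm_E_twelve.eq_of_coeff
    -- The weights solve a + b = 1 and 720a - 1008b = 65520/691.
    ((((isLevelOneForm_E_four.mul isLevelOneForm_E_four).mul isLevelOneForm_E_four).smul
      (441 / 691)).add ((isLevelOneForm_E_six.mul isLevelOneForm_E_six).smul (250 / 691)))
    (by norm_num)
    (by simp [ramanujanQ, ramanujanR, sigmaSeries]; norm_num)
    (by simp [ramanujanQ, ramanujanR, sigmaSeries, PowerSeries.coeff_mul,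
          Finset.Nat.antidiagonal_succ, PowerSeries.coeff_one]; norm_num)
  linear_combination (norm := algebra) (691 / 65520 : ℂ) • h

/-- The generating series of Ramanujan's tau function. -/
noncomputable def tauSeries : ℂ⟦X⟧ := PowerSeries.mk ramanujanTau

lemma tauSeries_eq : tauSeries = (1 / 1728 : ℂ) • (ramanujanQ ^ 3 - ramanujanR ^ 2) := by
  have h4 := isLevelOneForm_E_four.toHasQExpansion
  have h6 := isLevelOneForm_E_six.toHasQExpansion
  have h := ((((h4.mul h4).mul h4).smul (1 / 1728)).add ((h6.mul h6).smul (-1 / 1728)))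
  have hΔ : tauSeries = qExpansion 1 discriminant := by
    ext n
    simp [tauSeries, ramanujanTau]
  have hf : ((1 / 1728 : ℂ) • (⇑E₄ * ⇑E₄ * ⇑E₄) + (-1 / 1728 : ℂ) • (⇑E₆ * ⇑E₆) : ℍ → ℂ)
      = fun z : ℍ ↦ discriminant z := by
    ext z
    simp only [Pi.add_apply, Pi.smul_apply, Pi.mul_apply, smul_eq_mul,
      discriminant_eq_E₄_cube_sub_E₆_sq]
    ring
  rw [hf] at h
  have := h.eq_qExpansion
  rw [hΔ, ← this]
  algebra

lemma sigmaSeries_one : sigmaSeries 1 = (1 / 24 : ℂ) • (1 - ramanujanP) := by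
  rw [ramanujanP]
  algebra

lemma sigmaSeries_three : sigmaSeries 3 = (1 / 240 : ℂ) • (ramanujanQ - 1) := by
  rw [ramanujanQ]
  algebra

lemma sigmaSeries_five : sigmaSeries 5 = (1 / 504 : ℂ) • (1 - ramanujanR) := by
  rw [ramanujanR]
  algebra

/-! ### Twisted divisor sums -/

/-- The power series `∑ n ^ j * σ k n * q ^ n`. -/
noncomputable def twistedSigmaSeries (j k : ℕ) : ℂ⟦X⟧ := eulerDerivation^[j] (sigmaSeries k)

lemma twistedSigmaSeries_zero (k : ℕ) : twistedSigmaSeries 0 k = sigmaSeries k := rfl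

lemma twistedSigmaSeries_succ (j k : ℕ) :
    twistedSigmaSeries (j + 1) k = eulerDerivation (twistedSigmaSeries j k) :=
  Function.iterate_succ_apply' ..

lemma coeff_iterate_eulerDerivation (j n : ℕ) (A : ℂ⟦X⟧) :
    (eulerDerivation^[j] A).coeff n = (n : ℂ) ^ j * A.coeff n := by
  induction j with
  | zero => simp
  | succ j ih => rw [Function.iterate_succ_apply', coeff_eulerDerivation, ih]; ring

lemma coeff_twistedSigmaSeries (j k n : ℕ) :
    (twistedSigmaSeries j k).coeff n = (n : ℂ) ^ j * σ k n := by
  rw [twistedSigmaSeries, coeff_iterate_eulerDerivation, coeff_sigmaSeries]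

lemma coeff_twistedSigmaSeries_mul (j k l n : ℕ) :
    (twistedSigmaSeries j k * twistedSigmaSeries 0 l).coeff n =
      ∑ m ∈ Finset.Ico 1 n, (m : ℂ) ^ j * σ k m * σ l (n - m) := by
  rw [PowerSeries.coeff_mul, Finset.Nat.sum_antidiagonal_eq_sum_range_succ_mk]
  symm
  refine Finset.sum_subset_zero_on_sdiff (fun m hm ↦ ?_) (fun m hm ↦ ?_) (fun m hm ↦ ?_)
  · simp only [Finset.mem_Ico, Finset.mem_range] at hm ⊢
    omega
  · simp only [Finset.mem_Ico, Finset.mem_range, Finset.mem_sdiff] at hm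
    -- The end terms of the Cauchy product vanish because σ takes the value 0 at 0.
    obtain rfl | rfl : m = 0 ∨ m = n := by omega
    · simp [coeff_twistedSigmaSeries]
    · simp [coeff_twistedSigmaSeries]
  · simp only [coeff_twistedSigmaSeries, pow_zero, one_mul]

@[simp]
lemma eulerDerivation_two : eulerDerivation 2 = 0 := eulerDerivation.map_natCast 2

@[simp]
lemma eulerDerivation_three : eulerDerivation 3 = 0 := eulerDerivation.map_natCast 3

lemma eulerDerivation_twistedSigmaSeries_mul (i j k l : ℕ) :
    eulerDerivation (twistedSigmaSeries i k * twistedSigmaSeries j l) =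
      twistedSigmaSeries (i + 1) k * twistedSigmaSeries j l +
        twistedSigmaSeries i k * twistedSigmaSeries (j + 1) l := by
  rw [Derivation.leibniz, twistedSigmaSeries_succ i, twistedSigmaSeries_succ j, smul_eq_mul,
    smul_eq_mul]
  ring

lemma twistedSigmaSeries_one_one : twistedSigmaSeries 1 1 =
    (1 / 288 : ℂ) • (-ramanujanP ^ 2 + ramanujanQ) := by
  rw [twistedSigmaSeries_succ, twistedSigmaSeries_zero, sigmaSeries_one]
  simp [eulerDerivation_ramanujanP]
  algebra

lemma twistedSigmaSeries_two_one : twistedSigmaSeries 2 1 =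
    (1 / 1728 : ℂ) • (-ramanujanP ^ 3 + 3 * ramanujanP * ramanujanQ - 2 * ramanujanR) := by
  rw [twistedSigmaSeries_succ, twistedSigmaSeries_one_one]
  simp [Derivation.leibniz, pow_succ, eulerDerivation_ramanujanP, eulerDerivation_ramanujanQ]
  algebra

lemma twistedSigmaSeries_three_one : twistedSigmaSeries 3 1 =
    (1 / 6912 : ℂ) • (-ramanujanP ^ 4 + 6 * ramanujanP ^ 2 * ramanujanQ - 8 * ramanujanP * ramanujanR + 3 * ramanujanQ ^ 2) := by
  rw [twistedSigmaSeries_succ, twistedSigmaSeries_two_one]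
  simp [Derivation.leibniz, pow_succ, eulerDerivation_ramanujanP, eulerDerivation_ramanujanQ,
    eulerDerivation_ramanujanR]
  algebra

lemma twistedSigmaSeries_one_three : twistedSigmaSeries 1 3 =
    (1 / 720 : ℂ) • (ramanujanP * ramanujanQ - ramanujanR) := by
  rw [twistedSigmaSeries_succ, twistedSigmaSeries_zero, sigmaSeries_three]
  simp [eulerDerivation_ramanujanQ]
  algebra

lemma twistedSigmaSeries_two_three : twistedSigmaSeries 2 3 =
    (1 / 1728 : ℂ) • (ramanujanP ^ 2 * ramanujanQ - 2 * ramanujanP * ramanujanR + ramanujanQ ^ 2) := by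
  rw [twistedSigmaSeries_succ, twistedSigmaSeries_one_three]
  simp [Derivation.leibniz, eulerDerivation_ramanujanP, eulerDerivation_ramanujanQ,
    eulerDerivation_ramanujanR]
  algebra

lemma twistedSigmaSeries_three_three : twistedSigmaSeries 3 3 =
    (1 / 3456 : ℂ) • (ramanujanP ^ 3 * ramanujanQ - 3 * ramanujanP ^ 2 * ramanujanR + 3 * ramanujanP * ramanujanQ ^ 2 - ramanujanQ * ramanujanR) := by
  rw [twistedSigmaSeries_succ, twistedSigmaSeries_two_three]
  simp [Derivation.leibniz, pow_succ, eulerDerivation_ramanujanP, eulerDerivation_ramanujanQ,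
    eulerDerivation_ramanujanR]
  algebra

lemma twistedSigmaSeries_four_three : twistedSigmaSeries 4 3 =
    (1 / 41472 : ℂ) • (7 * ramanujanP ^ 4 * ramanujanQ - 28 * ramanujanP ^ 3 * ramanujanR + 42 * ramanujanP ^ 2 * ramanujanQ ^ 2 - 28 * ramanujanP * ramanujanQ * ramanujanR + 3 * ramanujanQ ^ 3 + 4 * ramanujanR ^ 2) := by
  rw [twistedSigmaSeries_succ, twistedSigmaSeries_three_three]
  simp [Derivation.leibniz, pow_succ, eulerDerivation_ramanujanP, eulerDerivation_ramanujanQ,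
    eulerDerivation_ramanujanR]
  algebra

lemma twistedSigmaSeries_one_five : twistedSigmaSeries 1 5 =
    (1 / 1008 : ℂ) • (-ramanujanP * ramanujanR + ramanujanQ ^ 2) := by
  rw [twistedSigmaSeries_succ, twistedSigmaSeries_zero, sigmaSeries_five]
  simp [eulerDerivation_ramanujanR]
  algebra

lemma twistedSigmaSeries_two_five : twistedSigmaSeries 2 5 =
    (1 / 1728 : ℂ) • (-ramanujanP ^ 2 * ramanujanR + 2 * ramanujanP * ramanujanQ ^ 2 - ramanujanQ * ramanujanR) := by
  rw [twistedSigmaSeries_succ, twistedSigmaSeries_one_five]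
  simp [Derivation.leibniz, pow_succ, eulerDerivation_ramanujanP, eulerDerivation_ramanujanQ,
    eulerDerivation_ramanujanR]
  algebra

lemma twistedSigmaSeries_three_five : twistedSigmaSeries 3 5 =
    (1 / 5184 : ℂ) • (-2 * ramanujanP ^ 3 * ramanujanR + 6 * ramanujanP ^ 2 * ramanujanQ ^ 2 - 6 * ramanujanP * ramanujanQ * ramanujanR + ramanujanQ ^ 3 + ramanujanR ^ 2) := by
  rw [twistedSigmaSeries_succ, twistedSigmaSeries_two_five]
  simp [Derivation.leibniz, pow_succ, eulerDerivation_ramanujanP, eulerDerivation_ramanujanQ,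
    eulerDerivation_ramanujanR]
  algebra

lemma twistedSigmaSeries_one_seven : twistedSigmaSeries 1 7 =
    (1 / 720 : ℂ) • (ramanujanP * ramanujanQ ^ 2 - ramanujanQ * ramanujanR) := by
  rw [twistedSigmaSeries_succ, twistedSigmaSeries_zero, sigmaSeries_seven]
  simp [Derivation.leibniz, pow_succ, eulerDerivation_ramanujanQ]
  algebra

lemma twistedSigmaSeries_two_seven : twistedSigmaSeries 2 7 =
    (1 / 8640 : ℂ) • (9 * ramanujanP ^ 2 * ramanujanQ ^ 2 - 18 * ramanujanP * ramanujanQ * ramanujanR + 5 * ramanujanQ ^ 3 + 4 * ramanujanR ^ 2) := by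
  rw [twistedSigmaSeries_succ, twistedSigmaSeries_one_seven]
  simp [Derivation.leibniz, pow_succ, eulerDerivation_ramanujanP, eulerDerivation_ramanujanQ,
    eulerDerivation_ramanujanR]
  algebra

lemma twistedSigmaSeries_one_nine : twistedSigmaSeries 1 9 =
    (1 / 1584 : ℂ) • (-5 * ramanujanP * ramanujanQ * ramanujanR + 3 * ramanujanQ ^ 3 + 2 * ramanujanR ^ 2) := by
  rw [twistedSigmaSeries_succ, twistedSigmaSeries_zero, sigmaSeries_nine]
  simp [Derivation.leibniz, eulerDerivation_ramanujanQ, eulerDerivation_ramanujanR]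
  algebra

/-! ### The nine identities between power series -/

lemma tauSeries_eq_sigma_nine : tauSeries =
      (5 * 691 / 9504 : ℂ) • twistedSigmaSeries 0 1 +
      (-(691 / 144) : ℂ) • twistedSigmaSeries 1 9 +
      (5 * 691 / 864 : ℂ) • twistedSigmaSeries 0 9 +
      (2275 / 1584 : ℂ) • twistedSigmaSeries 0 11 +
      (-(5 * 691 / 36) : ℂ) • (twistedSigmaSeries 0 1 * twistedSigmaSeries 0 9) := by
  simp only [tauSeries_eq, twistedSigmaSeries_zero, sigmaSeries_one, sigmaSeries_nine,
    sigmaSeries_eleven, twistedSigmaSeries_one_nine]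
  algebra

/-- The σ₁ term cancels the contribution of the constant in 480 S₇ = Q² - 1 (S₇ the series of σ₇),
as 225/480 = 15/32. What remains is homogeneous of weight 12 in P, Q, R. -/
lemma tauSeries_eq_sigma_seven : tauSeries =
      (15 / 32 : ℂ) • twistedSigmaSeries 1 1 +
      (-(33 / 32) : ℂ) • twistedSigmaSeries 1 9 +
      (50 / 32 : ℂ) • twistedSigmaSeries 2 7 +
      (225 : ℂ) • (twistedSigmaSeries 1 1 * twistedSigmaSeries 0 7) := by
  simp only [tauSeries_eq, twistedSigmaSeries_zero, sigmaSeries_seven,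
    twistedSigmaSeries_one_one, twistedSigmaSeries_one_nine, twistedSigmaSeries_two_seven]
  algebra

lemma tauSeries_eq_sigma_five : tauSeries =
      (6 / 7 : ℂ) • twistedSigmaSeries 2 1 +
      (-(9 / 7) : ℂ) • twistedSigmaSeries 3 5 +
      (10 / 7 : ℂ) • twistedSigmaSeries 2 7 +
      (-(24 * 18) : ℂ) • (twistedSigmaSeries 2 1 * twistedSigmaSeries 0 5) := by
  simp only [tauSeries_eq, twistedSigmaSeries_zero, sigmaSeries_five,
    twistedSigmaSeries_two_one, twistedSigmaSeries_two_seven, twistedSigmaSeries_three_five]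
  algebra

lemma tauSeries_eq_sigma_three : tauSeries =
      (14 / 5 : ℂ) • twistedSigmaSeries 3 1 +
      (12 / 5 : ℂ) • twistedSigmaSeries 4 3 +
      (-(21 / 5) : ℂ) • twistedSigmaSeries 3 5 +
      (24 * 28 : ℂ) • (twistedSigmaSeries 3 1 * twistedSigmaSeries 0 3) := by
  simp only [tauSeries_eq, twistedSigmaSeries_zero, sigmaSeries_three,
    twistedSigmaSeries_three_one, twistedSigmaSeries_three_five, twistedSigmaSeries_four_three]
  algebra

/-- A factor `n` inside the convolution sum is constant in `m`, so it becomes D applied to the whole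
product; the Leibniz rule then returns to products of twisted series. -/
lemma tauSeries_eq_sigma_seven' : tauSeries =
      (5 / 12 : ℂ) • twistedSigmaSeries 1 1 +
      (25 / 24 : ℂ) • twistedSigmaSeries 1 7 +
      (-(11 / 24) : ℂ) • twistedSigmaSeries 1 9 +
      (225 : ℂ) • (twistedSigmaSeries 1 1 * twistedSigmaSeries 0 7) +
      (-25 : ℂ) • (eulerDerivation^[1] (twistedSigmaSeries 0 1 * twistedSigmaSeries 0 7)) := by
  simp only [Function.iterate_succ_apply', Function.iterate_zero_apply,
    eulerDerivation_twistedSigmaSeries_mul, Nat.reduceAdd]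
  simp only [tauSeries_eq, twistedSigmaSeries_zero, sigmaSeries_one, sigmaSeries_seven,
    twistedSigmaSeries_one_one, twistedSigmaSeries_one_seven, twistedSigmaSeries_one_nine]
  algebra

lemma tauSeries_eq_sigma_five' : tauSeries =
      (9 / 14 : ℂ) • twistedSigmaSeries 2 1 +
      (5 / 14 : ℂ) • twistedSigmaSeries 2 7 +
      (-432 : ℂ) • (twistedSigmaSeries 2 1 * twistedSigmaSeries 0 5) +
      (108 : ℂ) • (eulerDerivation^[1] (twistedSigmaSeries 1 1 * twistedSigmaSeries 0 5)) := by
  simp only [Function.iterate_succ_apply', Function.iterate_zero_apply,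
    eulerDerivation_twistedSigmaSeries_mul, Nat.reduceAdd]
  simp only [tauSeries_eq, twistedSigmaSeries_zero, sigmaSeries_five,
    twistedSigmaSeries_one_one, twistedSigmaSeries_one_five, twistedSigmaSeries_two_one,
    twistedSigmaSeries_two_seven]
  algebra

lemma tauSeries_eq_sigma_three' : tauSeries =
      (8 / 5 : ℂ) • twistedSigmaSeries 3 1 +
      (-(3 / 5) : ℂ) • twistedSigmaSeries 3 5 +
      (672 : ℂ) • (twistedSigmaSeries 3 1 * twistedSigmaSeries 0 3) +
      (-288 : ℂ) • (eulerDerivation^[1] (twistedSigmaSeries 2 1 * twistedSigmaSeries 0 3)) := by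
  simp only [Function.iterate_succ_apply', Function.iterate_zero_apply,
    eulerDerivation_twistedSigmaSeries_mul, Nat.reduceAdd]
  simp only [tauSeries_eq, twistedSigmaSeries_zero, sigmaSeries_three,
    twistedSigmaSeries_one_three, twistedSigmaSeries_two_one, twistedSigmaSeries_three_one,
    twistedSigmaSeries_three_five]
  algebra

lemma tauSeries_eq_sigma_five'' : tauSeries =
      (1 / 2 : ℂ) • twistedSigmaSeries 2 1 +
      (1 / 2 : ℂ) • twistedSigmaSeries 2 5 +
      (-432 : ℂ) • (twistedSigmaSeries 2 1 * twistedSigmaSeries 0 5) +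
      (192 : ℂ) • (eulerDerivation^[1] (twistedSigmaSeries 1 1 * twistedSigmaSeries 0 5)) +
      (-12 : ℂ) • (eulerDerivation^[2] (twistedSigmaSeries 0 1 * twistedSigmaSeries 0 5)) := by
  simp only [Function.iterate_succ_apply', Function.iterate_zero_apply,
    eulerDerivation_twistedSigmaSeries_mul, Nat.reduceAdd, map_add]
  simp only [tauSeries_eq, twistedSigmaSeries_zero, sigmaSeries_one, sigmaSeries_five,
    twistedSigmaSeries_one_one, twistedSigmaSeries_one_five, twistedSigmaSeries_two_one,
    twistedSigmaSeries_two_five]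
  algebra

lemma tauSeries_eq_sigma_three'' : tauSeries =
      (1 : ℂ) • twistedSigmaSeries 3 1 +
      (-504 : ℂ) • (eulerDerivation^[1] (twistedSigmaSeries 2 1 * twistedSigmaSeries 0 3)) +
      (672 : ℂ) • (twistedSigmaSeries 3 1 * twistedSigmaSeries 0 3) +
      (72 : ℂ) • (eulerDerivation^[2] (twistedSigmaSeries 1 1 * twistedSigmaSeries 0 3)) := by
  simp only [Function.iterate_succ_apply', Function.iterate_zero_apply,
    eulerDerivation_twistedSigmaSeries_mul, Nat.reduceAdd, map_add]
  simp only [tauSeries_eq, twistedSigmaSeries_zero, sigmaSeries_three,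
    twistedSigmaSeries_one_one, twistedSigmaSeries_one_three, twistedSigmaSeries_two_one,
    twistedSigmaSeries_two_three, twistedSigmaSeries_three_one]
  algebra

end

/-! ### Comparison of coefficients -/

open scoped PowerSeries in
theorem theorem2p7 (n : ℕ) (hn : 1 ≤ n) :
    (ramanujanTau n =
      5 * 691 / 9504 * (σ 1 n : ℂ) - (6 * (n : ℂ) - 5) * 691 / 864 * (σ 9 n : ℂ)
        + 2275 / 1584 * (σ 11 n : ℂ)
        - 5 * 691 / 36 * ∑ m ∈ Finset.Ico 1 n, (σ 1 m : ℂ) * (σ 9 (n - m) : ℂ)) ∧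
    (ramanujanTau n =
      15 / 32 * (n : ℂ) * (σ 1 n : ℂ) - 33 / 32 * (n : ℂ) * (σ 9 n : ℂ)
        + 50 / 32 * (n : ℂ) ^ 2 * (σ 7 n : ℂ)
        + 225 * ∑ m ∈ Finset.Ico 1 n, (m : ℂ) * (σ 1 m : ℂ) * (σ 7 (n - m) : ℂ)) ∧
    (ramanujanTau n =
      6 / 7 * (n : ℂ) ^ 2 * (σ 1 n : ℂ) - 9 / 7 * (n : ℂ) ^ 3 * (σ 5 n : ℂ)
        + 10 / 7 * (n : ℂ) ^ 2 * (σ 7 n : ℂ)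
        - 24 * 18 * ∑ m ∈ Finset.Ico 1 n, (m : ℂ) ^ 2 * (σ 1 m : ℂ) * (σ 5 (n - m) : ℂ)) ∧
    (ramanujanTau n =
      14 / 5 * (n : ℂ) ^ 3 * (σ 1 n : ℂ) + 12 / 5 * (n : ℂ) ^ 4 * (σ 3 n : ℂ)
        - 21 / 5 * (n : ℂ) ^ 3 * (σ 5 n : ℂ)
        + 24 * 28 * ∑ m ∈ Finset.Ico 1 n, (m : ℂ) ^ 3 * (σ 1 m : ℂ) * (σ 3 (n - m) : ℂ)) ∧
    (ramanujanTau n =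
      5 / 12 * (n : ℂ) * (σ 1 n : ℂ) + 25 / 24 * (n : ℂ) * (σ 7 n : ℂ)
        - 11 / 24 * (n : ℂ) * (σ 9 n : ℂ)
        + 25 * ∑ m ∈ Finset.Ico 1 n,
            (9 * (m : ℂ) - (n : ℂ)) * (σ 1 m : ℂ) * (σ 7 (n - m) : ℂ)) ∧
    (ramanujanTau n =
      9 / 14 * (n : ℂ) ^ 2 * (σ 1 n : ℂ) + 5 / 14 * (n : ℂ) ^ 2 * (σ 7 n : ℂ)
        - 108 * ∑ m ∈ Finset.Ico 1 n,
            (4 * (m : ℂ) ^ 2 - (m : ℂ) * (n : ℂ)) * (σ 1 m : ℂ) * (σ 5 (n - m) : ℂ)) ∧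
    (ramanujanTau n =
      8 / 5 * (n : ℂ) ^ 3 * (σ 1 n : ℂ) - 3 / 5 * (n : ℂ) ^ 3 * (σ 5 n : ℂ)
        + 96 * ∑ m ∈ Finset.Ico 1 n,
            (7 * (m : ℂ) ^ 3 - 3 * (m : ℂ) ^ 2 * (n : ℂ)) * (σ 1 m : ℂ) * (σ 3 (n - m) : ℂ)) ∧
    (ramanujanTau n =
      1 / 2 * (n : ℂ) ^ 2 * (σ 1 n : ℂ) + 1 / 2 * (n : ℂ) ^ 2 * (σ 5 n : ℂ)
        - 12 * ∑ m ∈ Finset.Ico 1 n,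
            (36 * (m : ℂ) ^ 2 - 16 * (m : ℂ) * (n : ℂ) + (n : ℂ) ^ 2)
              * (σ 1 m : ℂ) * (σ 5 (n - m) : ℂ)) ∧
    (ramanujanTau n =
      (n : ℂ) ^ 3 * (σ 1 n : ℂ)
        - 24 * ∑ m ∈ Finset.Ico 1 n,
            (21 * (m : ℂ) ^ 2 * (n : ℂ) - 28 * (m : ℂ) ^ 3 - 3 * (m : ℂ) * (n : ℂ) ^ 2)
              * (σ 1 m : ℂ) * (σ 3 (n - m) : ℂ)) := by
  have h (A : ℂ⟦X⟧) (hA : tauSeries = A) : ramanujanTau n = A.coeff n := by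
    rw [← hA, tauSeries, PowerSeries.coeff_mk]
  refine ⟨(h _ tauSeries_eq_sigma_nine).trans ?_, (h _ tauSeries_eq_sigma_seven).trans ?_,
    (h _ tauSeries_eq_sigma_five).trans ?_, (h _ tauSeries_eq_sigma_three).trans ?_,
    (h _ tauSeries_eq_sigma_seven').trans ?_, (h _ tauSeries_eq_sigma_five').trans ?_,
    (h _ tauSeries_eq_sigma_three').trans ?_, (h _ tauSeries_eq_sigma_five'').trans ?_,
    (h _ tauSeries_eq_sigma_three'').trans ?_⟩ <;>
  simp only [map_add, PowerSeries.coeff_smul, coeff_twistedSigmaSeries_mul,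
    coeff_twistedSigmaSeries, coeff_iterate_eulerDerivation, smul_eq_mul, pow_zero, pow_one,
    one_mul, add_mul, sub_mul, Finset.sum_add_distrib, Finset.sum_sub_distrib, mul_assoc,
    mul_left_comm _ (n : ℂ), mul_left_comm _ ((n : ℂ) ^ 2), ← Finset.mul_sum] <;>
  ring
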